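/- Let $r\ge 2$ and $n\ge 0$ be integers and let $H_n^r(x)=(-1)^n e^{x^r}\frac{d^n}{dx^n}e^{-x^r}$. Then for every complex $x\neq 0$, $$H_n^r(x)=e^{x^r}\Bigl(-\frac rx\Bigr)^n\,G^{1,r}_{r,r+1}\Bigl(x^r\,\Big|\,{1-\frac1r,\;1-\frac2r,\;\ldots,\;0\atop 0,\;1+\frac{n-1}r,\;1+\frac{n-2}r,\;\ldots,\;\frac nr}\Bigr).$$ Here $G$ is the Meijer function, given for the parameters in question by the absolutely convergent Mellin–Barnes integral $$\frac1{2\pi i}\int_L \Gamma(-s)\prod_{i=1}^r\frac{\Gamma(\frac ir+s)}{\Gamma(\frac{i-n}r+s)}\,(x^r)^s\,ds$$ (principal power), where $L$ is any rectangular loop $+\infty-iT\to\sigma-iT\to\sigma+iT\to+\infty+iT$ with $T>0$ and $-\frac1r<\sigma<0$; that is, $L$ begins and ends at $+\infty$, encircles the poles $0,1,2,\ldots$ of $\Gamma(-s)$ once in the negative direction, and encircles no pole of the $\Gamma(\frac ir+s)$. The value does not depend on $\sigma$ and $T$. Moreover, $$H_n^r(x)=e^{x^r}\Bigl(-\frac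 rx\Bigr)^n\Bigl(\prod_{i=1}^r\Gamma\bigl(\tfrac ir\bigr)\Bigr)\;{}_r\widetilde F_r\Bigl[{\frac1r,\frac2r,\ldots,1\atop \frac{1-n}r,\frac{2-n}r,\ldots,\frac{r-n}r}\Big|-x^r\Bigr],$$ where ${}_p\widetilde F_q[{a_1,\ldots,a_p\atop b_1,\ldots,b_q}|z]=\sum_{j\ge0}\frac{\prod_i(a_i)_j}{\prod_i\Gamma(b_i+j)}\frac{z^j}{j!}$ is the regularized hypergeometric function, i.e. ${}_pF_q/\prod_i\Gamma(b_i)$ continued to all values of the $b_i$, with $1/\Gamma=0$ at the poles of $\Gamma$. -/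

import Mathlib

open MeasureTheory

noncomputable section

/-- The generalized Hermite function
`H_n^r(x) = (-1)^n exp(x^r) (d^n/dx^n) exp(-x^r)`, for complex `x`. -/
def generalizedHermite (r n : ℕ) (x : ℂ) : ℂ :=
  (-1) ^ n * Complex.exp (x ^ r) * iteratedDeriv n (fun y : ℂ => Complex.exp (-(y ^ r))) x

/-- The Mellin-Barnes integrand of `G^{m,n}_{p,q}(z | a ; b)`, as a function of `s`:
`∏_{j ≤ m} Γ(b_j - s) ∏_{k ≤ n} Γ(1 - a_k + s) z^s`
divided by `∏_{j > m} Γ(1 - b_j + s) ∏_{k > n} Γ(a_k - s)`.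
Indices start at `0` here; `z ^ s` is the principal power. As `Γ` has the value `0` at its poles
and `0⁻¹ = 0`, the expression `(Γ w)⁻¹` is the entire function `1/Γ` for every `w`. -/
def meijerIntegrand (m n : ℕ) {p q : ℕ} (a : Fin p → ℂ) (b : Fin q → ℂ) (z s : ℂ) : ℂ :=
  (∏ j : Fin q, if (j : ℕ) < m then Complex.Gamma (b j - s)
    else (Complex.Gamma (1 - b j + s))⁻¹) *
  (∏ k : Fin p, if (k : ℕ) < n then Complex.Gamma (1 - a k + s)
    else (Complex.Gamma (a k - s))⁻¹) * z ^ s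

/-- The loop which comes from `+∞ - iT` along a horizontal line to `σ - iT`, goes up to `σ + iT`
and returns horizontally to `+∞ + iT` (negative direction) encircles all poles of
`Γ(b_j - s)`, `j ≤ m`, that is all points `b_j + l`, and leaves outside all poles of
`Γ(1 - a_k + s)`, `k ≤ n`, that is all points `a_k - 1 - l`, `l = 0, 1, 2, …`. -/
def IsMeijerLoop (m n : ℕ) {p q : ℕ} (a : Fin p → ℂ) (b : Fin q → ℂ) (σ T : ℝ) : Prop :=
  0 < T ∧
  (∀ j : Fin q, (j : ℕ) < m → σ < (b j).re ∧ |(b j).im| < T) ∧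
  (∀ k : Fin p, (k : ℕ) < n → (a k).re - 1 < σ)

/-- The contour integral `(1 / 2πi) ∫ f(s) ds` along the loop
`+∞ - iT → σ - iT → σ + iT → +∞ + iT`. -/
def loopIntegral (f : ℂ → ℂ) (σ T : ℝ) : ℂ :=
  (2 * (Real.pi : ℂ) * Complex.I)⁻¹ *
    (-(∫ t in Set.Ioi σ, f ((t : ℂ) - (T : ℂ) * Complex.I))
      + Complex.I * (∫ y in (-T)..T, f ((σ : ℂ) + (y : ℂ) * Complex.I))
      + ∫ t in Set.Ioi σ, f ((t : ℂ) + (T : ℂ) * Complex.I))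

/-- Absolute convergence of the integral of `f` along the three pieces of the loop. -/
def LoopIntegrable (f : ℂ → ℂ) (σ T : ℝ) : Prop :=
  IntegrableOn (fun t : ℝ => f ((t : ℂ) - (T : ℂ) * Complex.I)) (Set.Ioi σ) ∧
  IntervalIntegrable (fun y : ℝ => f ((σ : ℂ) + (y : ℂ) * Complex.I)) volume (-T) T ∧
  IntegrableOn (fun t : ℝ => f ((t : ℂ) + (T : ℂ) * Complex.I)) (Set.Ioi σ)

/-- `w` is the value at `z` of the Meijer function `G^{m,n}_{p,q}(· | a ; b)`, given by its
Mellin-Barnes integral over a loop which begins and ends at `+∞` and encircles the poles of the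
`Γ(b_j - s)`, `j ≤ m`, once in the negative direction but none of the poles of the
`Γ(1 - a_k + s)`, `k ≤ n`. This is the contour used for `p < q`, `z ≠ 0` and for
`1 ≤ p = q`, `0 < |z| < 1`. The parameters have to be such that the two sets of poles can be
separated by a rectangular loop; the integral has to converge absolutely, with value `w`, over
every such loop. -/
structure HasMeijerG (m n : ℕ) {p q : ℕ} (a : Fin p → ℂ) (b : Fin q → ℂ) (z w : ℂ) : Prop where
  m_le : m ≤ q
  n_le : n ≤ p
  ne_zero : z ≠ 0
  order : p < q ∨ (1 ≤ p ∧ p = q ∧ ‖z‖ < 1)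
  exists_loop : ∃ σ T : ℝ, IsMeijerLoop m n a b σ T
  integrable : ∀ σ T : ℝ, IsMeijerLoop m n a b σ T →
    LoopIntegrable (meijerIntegrand m n a b z) σ T
  value : ∀ σ T : ℝ, IsMeijerLoop m n a b σ T →
    loopIntegral (meijerIntegrand m n a b z) σ T = w

theorem HasMeijerG.unique {m n p q : ℕ} {a : Fin p → ℂ} {b : Fin q → ℂ} {z w w' : ℂ}
    (h : HasMeijerG m n a b z w) (h' : HasMeijerG m n a b z w') : w = w' := by
  obtain ⟨σ, T, hL⟩ := h.exists_loop
  rw [← h.value σ T hL, h'.value σ T hL]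

open Classical in
/-- The Meijer function `G^{m,n}_{p,q}(z | a ; b)` (with the value `0` where the loop integral
does not define it). -/
def meijerG (m n : ℕ) {p q : ℕ} (a : Fin p → ℂ) (b : Fin q → ℂ) (z : ℂ) : ℂ :=
  if h : ∃ w, HasMeijerG m n a b z w then h.choose else 0

theorem HasMeijerG.meijerG_eq {m n p q : ℕ} {a : Fin p → ℂ} {b : Fin q → ℂ} {z w : ℂ}
    (h : HasMeijerG m n a b z w) : meijerG m n a b z = w := by
  have hex : ∃ w, HasMeijerG m n a b z w := ⟨w, h⟩
  rw [meijerG, dif_pos hex]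
  exact hex.choose_spec.unique h

/-- The upper parameters `1 - 1/r, 1 - 2/r, …, 1 - r/r = 0`. -/
def upperParams (r : ℕ) : Fin r → ℂ := fun i => 1 - ((i : ℕ) + 1 : ℂ) / r

/-- The lower parameters `0, 1 + (n-1)/r, 1 + (n-2)/r, …, 1 + (n-r)/r = n/r`. -/
def lowerParams (r n : ℕ) : Fin (r + 1) → ℂ :=
  Fin.cons 0 (fun i : Fin r => 1 + ((n : ℂ) - ((i : ℕ) + 1)) / r)

end

/-!
With `Q(s) = ∏_{k < n} (s - k / r)` (`gridPoly`) and `z = x ^ r`, all three expressions reduce to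
the entire series `S_n(z) = ∑_j (-1)^j / j! Q(j) z^j` (`residueSeries`).

* The quotient `∏ Γ(i/r + s) / Γ((i - n)/r + s)` telescopes: raising `n` by one shifts the window of
  the `r` reciprocal Gamma factors by one step and multiplies it by `s - n / r`. Hence for
  `Re s > -1/r` the quotient is the polynomial `Q` (`prod_Gamma_mul_prod_inv_Gamma`) and the
  Mellin-Barnes integrand is `Γ(-s) Q(s) z^s`.
* Moving the left edge of the loop from `σ + j` to `σ + j + 1` crosses the single pole `s = j` and
  changes the integral by `(-1)^j / j! Q(j) z^j` (`loopIntegral_reducedIntegrand_sub_succ`), by the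
  residue theorem for a rectangle. The recurrence of `Γ` makes `Γ(-s)` decay factorially under
  `s ↦ s + 1`, so that the integral converges absolutely and tends to `0` as the loop moves to the
  right. Thus the Meijer function is `S_n(z)` (`hasMeijerG_residueSeries`).
* `S_0(z) = e^{-z}` and `S_{n+1} = (z d/dz - n / r) S_n`. In the variable `x` this is the rule
  `d/dx [(r / x)^n S_n(x^r)] = (r / x)^{n+1} S_{n+1}(x^r)`, so that the `n`-th derivative of
  `exp(-x^r)` is `(r / x)^n S_n(x^r)` (`iteratedDeriv_exp_neg_pow`).
* Evaluated at `s = j`, the Gamma quotient gives the coefficients of the regularized hypergeometric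
  series (`prod_Gamma_mul_regularizedHGFun`).
-/

/-! ### Integrals over the boundary of a rectangle -/

open Complex in
/-- The integral of `f` over the boundary of `[a, b] × [-T, T]`, in the positive direction. -/
noncomputable def rectBoundaryIntegral (f : ℂ → ℂ) (a b T : ℝ) : ℂ :=
  (∫ t in a..b, f ((t : ℂ) - (T : ℂ) * I)) - (∫ t in a..b, f ((t : ℂ) + (T : ℂ) * I))
    + I * (∫ y in (-T)..T, f ((b : ℂ) + (y : ℂ) * I))
    - I * (∫ y in (-T)..T, f ((a : ℂ) + (y : ℂ) * I))

open Complex in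
/-- `∮ ds / (s - c) = 2πi` for a real point `c` inside the rectangle. The bottom, right and top
edges lie in the slit plane of `log (s - c)`, the left one in that of `log (c - s)`. -/
theorem rectBoundaryIntegral_sub_inv {a b c T : ℝ} (hac : a < c) (hcb : c < b) (hT : 0 < T) :
    rectBoundaryIntegral (fun s => (s - c)⁻¹) a b T = 2 * Real.pi * I := by
  have horiz (T' : ℝ) (hT' : T' ≠ 0) : ∫ t in a..b, ((t : ℂ) + (T' : ℂ) * I - c)⁻¹ =
      log (b + T' * I - c) - log (a + T' * I - c) := by
    have hne (t : ℝ) : (t : ℂ) + (T' : ℂ) * I - c ∈ slitPlane := by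
      right; simpa using hT'
    refine intervalIntegral.integral_eq_sub_of_hasDerivAt
      (f := fun t : ℝ => log ((t : ℂ) + (T' : ℂ) * I - c)) (fun t _ => ?_) ?_
    · have h1 : HasDerivAt (fun t : ℝ => (t : ℂ) + (T' : ℂ) * I - c) 1 t :=
        ((hasDerivAt_id t).ofReal_comp.add_const _).sub_const _
      simpa using h1.clog_real (hne t)
    · refine Continuous.intervalIntegrable ?_ _ _
      exact Continuous.inv₀ (by fun_prop) fun t => slitPlane_ne_zero (hne t)
  have vert (u : ℝ) (hu : 0 < u) : I * ∫ y in (-T)..T, ((u : ℂ) + (y : ℂ) * I)⁻¹ =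
      log (u + T * I) - log (u - T * I) := by
    have hne (y : ℝ) : (u : ℂ) + (y : ℂ) * I ∈ slitPlane := by
      left; simpa using hu
    have h := intervalIntegral.integral_eq_sub_of_hasDerivAt (a := -T) (b := T)
      (f := fun y : ℝ => log ((u : ℂ) + (y : ℂ) * I))
      (f' := fun y : ℝ => I * ((u : ℂ) + (y : ℂ) * I)⁻¹) (fun y _ => ?_) ?_
    · rw [intervalIntegral.integral_const_mul] at h
      rw [h]; push_cast; ring_nf
    · have h1 : HasDerivAt (fun y : ℝ => (u : ℂ) + (y : ℂ) * I) I y := by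
        simpa using ((hasDerivAt_id y).ofReal_comp.mul_const I).const_add (u : ℂ)
      simpa [div_eq_mul_inv] using h1.clog_real (hne y)
    · refine Continuous.intervalIntegrable ?_ _ _
      exact continuous_const.mul (Continuous.inv₀ (by fun_prop) fun t => slitPlane_ne_zero (hne t))
  have hb := horiz (-T) (by linarith)
  have ht := horiz T hT.ne'
  have hr := vert (b - c) (by linarith)
  have hl := vert (c - a) (by linarith)
  have hl' : I * ∫ y in (-T)..T, ((a : ℂ) + (y : ℂ) * I - c)⁻¹ =
      -(log (c - a + T * I) - log (c - a - T * I)) := by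
    have : ∫ y in (-T)..T, ((a : ℂ) + (y : ℂ) * I - c)⁻¹ =
        - ∫ y in (-T)..T, (((c - a : ℝ) : ℂ) + (y : ℂ) * I)⁻¹ := by
      have h := intervalIntegral.integral_comp_neg (a := -T) (b := T)
        (fun y : ℝ => (((c - a : ℝ) : ℂ) + (y : ℂ) * I)⁻¹)
      rw [neg_neg] at h
      rw [← h, ← intervalIntegral.integral_neg]
      refine intervalIntegral.integral_congr fun y _ => ?_
      rw [← inv_neg]
      congr 1
      push_cast
      ring
    rw [this, mul_neg, hl]
    push_cast
    ring
  -- the two logarithms differ by `πi` on either end of the left edge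
  have hneg (z : ℂ) (hz : 0 < z.im) : log (-z) = log z - Real.pi * I := by
    simp only [log, norm_neg, arg_neg_eq_arg_sub_pi_of_im_pos hz]
    push_cast
    ring
  have e1 := hneg (a + T * I - c) (by simpa using hT)
  have e2 := hneg (c - a + T * I) (by simpa using hT)
  rw [show -((a : ℂ) + T * I - c) = c - a - T * I by ring] at e1
  rw [show -((c : ℂ) - a + T * I) = a - T * I - c by ring] at e2
  simp only [rectBoundaryIntegral]
  have r1 : ∫ t in a..b, ((t : ℂ) - (T : ℂ) * I - c)⁻¹ =
      log (b - T * I - c) - log (a - T * I - c) := by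
    convert hb using 3 <;> push_cast <;> ring_nf
  have r2 : I * ∫ y in (-T)..T, ((b : ℂ) + (y : ℂ) * I - c)⁻¹ =
      log (b + T * I - c) - log (b - T * I - c) := by
    have e (y : ℝ) : (b : ℂ) + (y : ℂ) * I - c = ((b - c : ℝ) : ℂ) + (y : ℂ) * I := by
      push_cast; ring
    simp only [e]
    rw [hr]
    push_cast
    ring_nf
  rw [r1, ht, r2, hl', e1, e2]
  ring

open Complex in
/-- Residue theorem on a rectangle, for one simple pole at a real point inside it. -/
theorem rectBoundaryIntegral_of_simple_pole {f g : ℂ → ℂ} {a b c T : ℝ} (hac : a < c) (hcb : c < b)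
    (hT : 0 < T) (hg : DifferentiableOn ℂ g (Set.Icc a b ×ℂ Set.Icc (-T) T))
    (hf : ∀ s ∈ Set.Icc a b ×ℂ Set.Icc (-T) T, s ≠ c → f s = g s / (s - c)) :
    rectBoundaryIntegral f a b T = 2 * Real.pi * I * g c := by
  have hab : a ≤ b := by linarith
  have hTT : -T ≤ T := by linarith
  set R : Set ℂ := Set.Icc a b ×ℂ Set.Icc (-T) T with hR
  have hRc : R ∈ nhds (c : ℂ) := by
    have : Set.Ioo a b ×ℂ Set.Ioo (-T) T ∈ nhds (c : ℂ) :=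
      (isOpen_Ioo.reProdIm isOpen_Ioo).mem_nhds (by simp [mem_reProdIm, *])
    exact Filter.mem_of_superset this
      (reProdIm_subset_iff.2 (Set.prod_mono Set.Ioo_subset_Icc_self Set.Ioo_subset_Icc_self))
  have hd : DifferentiableOn ℂ (dslope g c) R := (differentiableOn_dslope hRc).2 hg
  have h0 := integral_boundary_rect_eq_zero_of_differentiableOn (dslope g c)
    ((a : ℂ) - T * I) ((b : ℂ) + T * I) (by simpa [Set.uIcc_of_le hab, Set.uIcc_of_le hTT] using hd)
  have h1 := rectBoundaryIntegral_sub_inv hac hcb hT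
  -- each edge integral splits according to `f s = dslope g c s + g c / (s - c)`
  have split (γ : ℝ → ℂ) (hγ : Continuous γ) (u v : ℝ) (huv : u ≤ v)
      (hmem : ∀ t ∈ Set.Icc u v, γ t ∈ R) (hne : ∀ t, γ t ≠ c) :
      ∫ t in u..v, f (γ t) =
        (∫ t in u..v, dslope g c (γ t)) + g c * ∫ t in u..v, (γ t - c)⁻¹ := by
    rw [← intervalIntegral.integral_const_mul, ← intervalIntegral.integral_add]
    · refine intervalIntegral.integral_congr fun t ht => ?_
      rw [Set.uIcc_of_le huv] at ht
      rw [hf _ (hmem t ht) (hne t), dslope_of_ne _ (hne t), slope_def_field]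
      have := sub_ne_zero.2 (hne t)
      field_simp
      ring
    · refine ContinuousOn.intervalIntegrable_of_Icc huv ?_
      exact hd.continuousOn.comp hγ.continuousOn hmem
    · refine Continuous.intervalIntegrable ?_ _ _
      exact continuous_const.mul
        (Continuous.inv₀ (by fun_prop) fun t => sub_ne_zero.2 (hne t))
  have s1 := split (fun t : ℝ => (t : ℂ) - T * I) (by fun_prop) a b hab
    (fun t ht => by simpa [R, mem_reProdIm, hT.le] using ht)
    (fun t h => by have := congrArg im h; simp at this; exact hT.ne' this)
  have s2 := split (fun t : ℝ => (t : ℂ) + T * I) (by fun_prop) a b hab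
    (fun t ht => by simpa [R, mem_reProdIm, hT.le, hTT] using ht)
    (fun t h => by have := congrArg im h; simp at this; exact hT.ne' this)
  have s3 := split (fun y : ℝ => (b : ℂ) + y * I) (by fun_prop) (-T) T hTT
    (fun t ht => by simpa [R, mem_reProdIm, hab] using ht)
    (fun t h => by have := congrArg re h; simp at this; linarith)
  have s4 := split (fun y : ℝ => (a : ℂ) + y * I) (by fun_prop) (-T) T hTT
    (fun t ht => by simpa [R, mem_reProdIm, hab] using ht)
    (fun t h => by have := congrArg re h; simp at this; linarith)
  simp only [rectBoundaryIntegral] at h1 ⊢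
  rw [s1, s2, s3, s4]
  simp [← sub_eq_add_neg] at h0
  linear_combination h0 + g c * h1

open Complex in
/-- Loops with left edges at `a ≤ b` differ by a rectangle, run in the negative direction. -/
theorem loopIntegral_sub_loopIntegral {f : ℂ → ℂ} {a b T : ℝ} (hab : a ≤ b)
    (hf : LoopIntegrable f a T) :
    loopIntegral f a T - loopIntegral f b T =
      -((2 * (Real.pi : ℂ) * I)⁻¹ * rectBoundaryIntegral f a b T) := by
  have h1 := intervalIntegral.integral_Ioi_sub_Ioi hf.1 hab
  have h2 := intervalIntegral.integral_Ioi_sub_Ioi hf.2.2 hab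
  simp only [loopIntegral, rectBoundaryIntegral, ← h1, ← h2]
  ring

/-! ### Collapse of the Gamma quotient -/

/-- The polynomial `∏_{k < n} (s - k / r)` to which the quotient of Gamma products in the
Mellin-Barnes integrand collapses. -/
noncomputable def gridPoly (r n : ℕ) (s : ℂ) : ℂ := ∏ k ∈ Finset.range n, (s - (k : ℂ) / r)

open Complex in
/-- Raising `n` by one moves the window of the `r` reciprocal Gamma factors by one step, which
trades `1 / Γ(s - n / r + 1)` for `1 / Γ(s - n / r) = (s - n / r) / Γ(s - n / r + 1)`. -/
theorem prod_inv_Gamma_eq_gridPoly_mul {r : ℕ} (hr : r ≠ 0) (n : ℕ) (s : ℂ) :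
    ∏ i ∈ Finset.range r, (Gamma (((i : ℂ) + 1 - n) / r + s))⁻¹ =
      gridPoly r n s * ∏ i ∈ Finset.range r, (Gamma (((i : ℂ) + 1) / r + s))⁻¹ := by
  induction n with
  | zero => simp [gridPoly]
  | succ n ih =>
    have hstep : ∏ i ∈ Finset.range r, (Gamma (((i : ℂ) + 1 - (n + 1 : ℕ)) / r + s))⁻¹ =
        (s - (n : ℂ) / r) * ∏ i ∈ Finset.range r, (Gamma (((i : ℂ) + 1 - n) / r + s))⁻¹ := by
      obtain ⟨m, rfl⟩ := Nat.exists_eq_succ_of_ne_zero hr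
      rw [Finset.prod_range_succ', Finset.prod_range_succ]
      have hm : ((m + 1 : ℕ) : ℂ) ≠ 0 := by exact_mod_cast hr
      have hrec := one_div_Gamma_eq_self_mul_one_div_Gamma_add_one (s - (n : ℂ) / (m + 1 : ℕ))
      have e1 : (((0 : ℕ) : ℂ) + 1 - (n + 1 : ℕ)) / (m + 1 : ℕ) + s =
          s - (n : ℂ) / (m + 1 : ℕ) := by
        push_cast; ring
      have e2 : s - (n : ℂ) / (m + 1 : ℕ) + 1 = ((m : ℂ) + 1 - n) / (m + 1 : ℕ) + s := by
        have : ((m : ℂ) + 1) / (m + 1 : ℕ) = 1 := by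
          rw [← Nat.cast_succ]; exact div_self hm
        rw [sub_div, this]; ring
      rw [e1, hrec, e2]
      have : ∀ i ∈ Finset.range m,
          (Gamma ((((i + 1 : ℕ) : ℂ) + 1 - (n + 1 : ℕ)) / (m + 1 : ℕ) + s))⁻¹
          = (Gamma (((i : ℂ) + 1 - n) / (m + 1 : ℕ) + s))⁻¹ := by
        intro i _
        congr 4
        push_cast
        ring
      rw [Finset.prod_congr rfl this]
      ring
    rw [hstep, ih, gridPoly, gridPoly, Finset.prod_range_succ]
    ring

open Complex in
/-- To the right of all poles of the `Γ(i / r + s)` the quotient of Gamma products is a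
polynomial. -/
theorem prod_Gamma_mul_prod_inv_Gamma {r : ℕ} (hr : r ≠ 0) (n : ℕ) {s : ℂ}
    (hs : -(1 / r : ℝ) < s.re) :
    (∏ i ∈ Finset.range r, Gamma (((i : ℂ) + 1) / r + s)) *
      ∏ i ∈ Finset.range r, (Gamma (((i : ℂ) + 1 - n) / r + s))⁻¹ = gridPoly r n s := by
  rw [prod_inv_Gamma_eq_gridPoly_mul hr, mul_left_comm, ← Finset.prod_mul_distrib]
  rw [Finset.prod_eq_one, mul_one]
  intro i _
  refine mul_inv_cancel₀ (Gamma_ne_zero_of_re_pos ?_)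
  have h1 : (((i : ℂ) + 1) / r + s).re = ((i : ℝ) + 1) / r + s.re := by
    rw [add_re, ← ofReal_natCast i, ← ofReal_natCast r, ← ofReal_one, ← ofReal_add, ← ofReal_div,
      ofReal_re]
  have h2 : (1 / r : ℝ) ≤ ((i : ℝ) + 1) / r := by
    gcongr
    linarith [(Nat.cast_nonneg i : (0 : ℝ) ≤ i)]
  rw [h1]
  linarith

/-- The Mellin-Barnes integrand after cancellation: `Γ(-s) ∏_{k < n} (s - k / r) z ^ s`. -/
noncomputable def reducedIntegrand (r n : ℕ) (z s : ℂ) : ℂ :=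
  Complex.Gamma (-s) * gridPoly r n s * z ^ s

open Complex in
theorem meijerIntegrand_eq_reducedIntegrand {r : ℕ} (hr : r ≠ 0) (n : ℕ) (z : ℂ) {s : ℂ}
    (hs : -(1 / r : ℝ) < s.re) :
    meijerIntegrand 1 r (upperParams r) (lowerParams r n) z s = reducedIntegrand r n z s := by
  rw [meijerIntegrand, reducedIntegrand, ← prod_Gamma_mul_prod_inv_Gamma hr n hs,
    Fin.prod_univ_succ, Finset.prod_range, Finset.prod_range]
  have hU (k : Fin r) : 1 - upperParams r k + s = ((k : ℕ) + 1 : ℂ) / r + s := by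
    simp [upperParams]
  have hL (k : Fin r) : 1 - (1 + ((n : ℂ) - ((k : ℕ) + 1)) / r) + s =
      ((k : ℕ) + 1 - n : ℂ) / r + s := by ring
  simp only [lowerParams, Fin.cons_zero, Fin.cons_succ, Fin.val_zero, Fin.val_succ, hU, hL,
    Fin.is_lt, if_true, zero_sub, Nat.lt_one_iff, Nat.succ_ne_zero, if_false]
  ring

open Complex in
/-- The nearest poles that a loop has to separate are `0` and `-1 / r`. -/
theorem isMeijerLoop_iff {r : ℕ} (hr : r ≠ 0) (n : ℕ) (σ T : ℝ) :
    IsMeijerLoop 1 r (upperParams r) (lowerParams r n) σ T ↔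
      0 < T ∧ σ < 0 ∧ -(1 / r : ℝ) < σ := by
  have hU (k : Fin r) : (upperParams r k).re - 1 = -(((k : ℕ) + 1 : ℝ) / r) := by
    have : upperParams r k = ((1 - ((k : ℕ) + 1 : ℝ) / r : ℝ) : ℂ) := by
      simp [upperParams]
    rw [this, ofReal_re]
    ring
  constructor
  · rintro ⟨hT, h1, h2⟩
    refine ⟨hT, ?_, ?_⟩
    · simpa [lowerParams] using (h1 0 (by simp)).1
    · have := h2 ⟨0, Nat.pos_of_ne_zero hr⟩ (Nat.pos_of_ne_zero hr)
      rw [hU] at this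
      simpa using this
  · rintro ⟨hT, h1, h2⟩
    refine ⟨hT, fun j hj => ?_, fun k _ => ?_⟩
    · obtain rfl : j = 0 := Fin.ext (by simpa using hj)
      simpa [lowerParams] using ⟨h1, hT⟩
    · rw [hU]
      have : (1 / r : ℝ) ≤ ((k : ℕ) + 1 : ℝ) / r := by
        gcongr
        linarith [(Nat.cast_nonneg (k : ℕ) : (0 : ℝ) ≤ (k : ℕ))]
      linarith

open Complex in
theorem norm_gridPoly_le {r : ℕ} (n : ℕ) (s : ℂ) :
    ‖gridPoly r n s‖ ≤ (n.factorial : ℝ) * Real.exp (‖s‖ + n) := by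
  have h1 : ‖gridPoly r n s‖ ≤ (‖s‖ + n) ^ n := by
    rw [gridPoly, norm_prod]
    calc ∏ k ∈ Finset.range n, ‖s - (k : ℂ) / r‖ ≤ ∏ _k ∈ Finset.range n, (‖s‖ + n) := by
          refine Finset.prod_le_prod (fun _ _ => norm_nonneg _) fun k hk => ?_
          refine (norm_sub_le _ _).trans ?_
          gcongr
          rw [norm_div, norm_natCast, norm_natCast]
          have hk' : (k : ℝ) ≤ n := by exact_mod_cast (Finset.mem_range.1 hk).le
          rcases Nat.eq_zero_or_pos r with rfl | hr
          · simp
          · exact (div_le_self k.cast_nonneg (by exact_mod_cast hr)).trans hk'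
      _ = _ := by simp
  have h2 := Real.pow_div_factorial_le_exp (‖s‖ + n) (by positivity) n
  rw [div_le_iff₀ (by positivity)] at h2
  linarith


/-! ### The power series of the residues and the derivatives of `exp (-x ^ r)` -/

open Complex in
/-- The residue of the integrand at `j`, up to the sign that the negative direction of the loop
compensates. -/
noncomputable def residueTerm (r n : ℕ) (z : ℂ) (j : ℕ) : ℂ :=
  (-1) ^ j / j.factorial * gridPoly r n j * z ^ j

theorem norm_residueTerm (r n : ℕ) (z : ℂ) (j : ℕ) :
    ‖residueTerm r n z j‖ = 1 / j.factorial * ‖gridPoly r n j‖ * ‖z‖ ^ j := by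
  simp [residueTerm]

theorem summable_norm_residueTerm (r n : ℕ) (z : ℂ) :
    Summable fun j => ‖residueTerm r n z j‖ := by
  refine Summable.of_nonneg_of_le (fun _ => norm_nonneg _) (fun j => ?_)
    ((Real.summable_pow_div_factorial (Real.exp 1 * ‖z‖)).mul_left
      ((n.factorial : ℝ) * Real.exp n))
  rw [norm_residueTerm]
  have h := norm_gridPoly_le (r := r) n (j : ℂ)
  rw [Complex.norm_natCast, Real.exp_add] at h
  calc 1 / (j.factorial : ℝ) * ‖gridPoly r n j‖ * ‖z‖ ^ j
      ≤ 1 / (j.factorial : ℝ) * (n.factorial * (Real.exp j * Real.exp n)) * ‖z‖ ^ j := by gcongr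
    _ = _ := by
      rw [mul_pow, ← Real.exp_nat_mul, mul_one]
      ring

theorem summable_residueTerm (r n : ℕ) (z : ℂ) : Summable (residueTerm r n z) :=
  (summable_norm_residueTerm r n z).of_norm

/-- The sum of the residues, as a power series in `z`. -/
noncomputable def residueSeries (r n : ℕ) (z : ℂ) : ℂ := ∑' j, residueTerm r n z j

theorem natCast_mul_gridPoly (r n j : ℕ) :
    (j : ℂ) * gridPoly r n j = gridPoly r (n + 1) j + (n : ℂ) / r * gridPoly r n j := by
  rw [gridPoly, gridPoly, Finset.prod_range_succ]
  ring

theorem natCast_mul_residueTerm (r n : ℕ) (z : ℂ) (j : ℕ) :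
    (j : ℂ) * residueTerm r n z j =
      residueTerm r (n + 1) z j + (n : ℂ) / r * residueTerm r n z j := by
  simp only [residueTerm]
  linear_combination (-1) ^ j / (j.factorial : ℂ) * z ^ j * natCast_mul_gridPoly r n j

/-- The Euler operator `z d/dz - n / r` takes the series for `n` to the series for `n + 1`. -/
theorem exists_hasDerivAt_residueSeries (r n : ℕ) (z : ℂ) :
    ∃ d, HasDerivAt (residueSeries r n) d z ∧
      z * d = residueSeries r (n + 1) z + (n : ℂ) / r * residueSeries r n z := by
  -- differentiation under the sum on the ball of radius `R`;
  -- `1 ≤ R` bounds `R ^ (j - 1)` by `R ^ j`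
  set R : ℝ := ‖z‖ + 1
  have hR : 1 ≤ R := by simp [R]
  let c (j : ℕ) : ℂ := (-1) ^ j / j.factorial * gridPoly r n j
  have hu := (summable_norm_residueTerm r (n + 1) (R : ℂ)).add
    ((summable_norm_residueTerm r n (R : ℂ)).mul_left ‖(n : ℂ) / r‖)
  refine ⟨∑' j, c j * (j * z ^ (j - 1)), ?_, ?_⟩
  · refine hasDerivAt_tsum_of_isPreconnected (g := fun j y => residueTerm r n y j)
      (g' := fun j y => c j * (j * y ^ (j - 1))) hu
      (Metric.isOpen_ball (x := (0 : ℂ)) (ε := R)) (convex_ball _ _).isPreconnected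
      (fun j y _ => (hasDerivAt_pow j y).const_mul (c j)) (fun j y hy => ?_) (y₀ := z) ?_
      (summable_residueTerm r n z) ?_
    · have hy' : ‖y‖ ≤ R := by simpa using (mem_ball_zero_iff.1 hy).le
      calc ‖c j * (j * y ^ (j - 1))‖ = ‖c j‖ * (j * ‖y‖ ^ (j - 1)) := by simp
        _ ≤ ‖c j‖ * (j * R ^ j) := by
          gcongr
          exact (pow_le_pow_left₀ (norm_nonneg _) hy' _).trans
            (pow_le_pow_right₀ hR (Nat.sub_le _ _))
        _ = ‖(j : ℂ) * residueTerm r n (R : ℂ) j‖ := by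
          simp only [residueTerm, norm_mul, norm_pow, Complex.norm_natCast, Complex.norm_real,
            Real.norm_of_nonneg (zero_le_one.trans hR), c]
          ring
        _ ≤ _ := by
          rw [natCast_mul_residueTerm]
          exact (norm_add_le _ _).trans (by rw [norm_mul])
    · simp [R]
    · simp [R]
  · rw [residueSeries, residueSeries, ← tsum_mul_left, ← tsum_mul_left,
      ← (summable_residueTerm r (n + 1) z).tsum_add ((summable_residueTerm r n z).mul_left _)]
    refine tsum_congr fun j => ?_
    rw [← natCast_mul_residueTerm]
    cases j with
    | zero => simp
    | succ j =>
      simp only [residueTerm, c, Nat.add_sub_cancel, pow_succ z]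
      ring

theorem residueSeries_zero (r : ℕ) (z : ℂ) : residueSeries r 0 z = Complex.exp (-z) := by
  rw [Complex.exp_eq_exp_ℂ, NormedSpace.exp_eq_tsum_div]
  refine tsum_congr fun j => ?_
  rw [residueTerm, gridPoly, Finset.prod_range_zero, neg_pow z]
  ring

theorem iteratedDeriv_exp_neg_pow {r : ℕ} (hr : r ≠ 0) (n : ℕ) {x : ℂ} (hx : x ≠ 0) :
    iteratedDeriv n (fun y : ℂ => Complex.exp (-(y ^ r))) x =
      ((r : ℂ) / x) ^ n * residueSeries r n (x ^ r) := by
  induction n generalizing x with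
  | zero => simp [residueSeries_zero]
  | succ n ih =>
    rw [iteratedDeriv_succ]
    have hev : iteratedDeriv n (fun y : ℂ => Complex.exp (-(y ^ r))) =ᶠ[nhds x]
        fun y => ((r : ℂ) / y) ^ n * residueSeries r n (y ^ r) := by
      filter_upwards [isOpen_ne.mem_nhds hx] with y hy using ih hy
    rw [hev.deriv_eq]
    obtain ⟨d, hd, hzd⟩ := exists_hasDerivAt_residueSeries r n (x ^ r)
    have h1 : HasDerivAt (fun y : ℂ => ((r : ℂ) / y) ^ n)
        (n * ((r : ℂ) / x) ^ (n - 1) * (r * -(x ^ 2)⁻¹)) x := by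
      simpa [div_eq_mul_inv] using ((hasDerivAt_inv hx).const_mul (r : ℂ)).fun_pow n
    have h2 : HasDerivAt (fun y : ℂ => residueSeries r n (y ^ r)) (d * (r * x ^ (r - 1))) x :=
      hd.comp x (hasDerivAt_pow r x)
    rw [(h1.fun_mul h2).deriv]
    have hr' : (r : ℂ) ≠ 0 := by exact_mod_cast hr
    have h3 : x ^ r = x * x ^ (r - 1) := by
      rw [← pow_succ', Nat.sub_add_cancel (Nat.pos_of_ne_zero hr)]
    have h4 : (n : ℂ) * ((r : ℂ) / x) ^ (n - 1) * (r / x) = n * ((r : ℂ) / x) ^ n := by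
      cases n with
      | zero => simp
      | succ n => rw [Nat.add_sub_cancel, pow_succ]; ring
    have h5 : residueSeries r (n + 1) (x ^ r) =
        x * x ^ (r - 1) * d - (n : ℂ) / r * residueSeries r n (x ^ r) := by
      rw [← h3, hzd]; ring
    have h6 : (n : ℂ) * ((r : ℂ) / x) ^ (n - 1) * (r * -(x ^ 2)⁻¹) =
        -(n / x * (r / x) ^ n) := by
      have : (n : ℂ) * ((r : ℂ) / x) ^ (n - 1) * (r * -(x ^ 2)⁻¹) =
        -((n : ℂ) * ((r : ℂ) / x) ^ (n - 1) * (r / x)) / x := by field_simp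
      rw [this, h4]
      ring
    rw [h5, h6, pow_succ]
    field_simp
    ring

/-! ### The regularized hypergeometric function -/

open Complex in
/-- The coefficients agree because `Γ(i / r) (i / r)_j = Γ(i / r + j)`. -/
theorem prod_Gamma_mul_regularizedHGFun {r : ℕ} (hr : r ≠ 0) (n : ℕ) (z : ℂ) :
    (∏ i ∈ Finset.Icc 1 r, Gamma ((i : ℂ) / r)) *
      regularizedHGFun ((Finset.Icc 1 r).val.map fun i : ℕ => (i : ℂ) / r)
        ((Finset.Icc 1 r).val.map fun i : ℕ => ((i : ℂ) - n) / r) (-z) = residueSeries r n z := by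
  have hIcc (f : ℕ → ℂ) : ∏ i ∈ Finset.Icc 1 r, f i = ∏ i ∈ Finset.range r, f (i + 1) := by
    have : Finset.Icc 1 r = Finset.Ico 1 (r + 1) := by ext; simp
    rw [this, Finset.prod_Ico_eq_prod_range]
    simp [add_comm]
  have hsum := FormalMultilinearSeries.ofScalars_sum_eq
    (regularizedHGFunCoeff ((Finset.Icc 1 r).val.map fun i : ℕ => (i : ℂ) / r)
        ((Finset.Icc 1 r).val.map fun i : ℕ => ((i : ℂ) - n) / r)) (-z)
  rw [FormalMultilinearSeries.ofScalarsSum] at hsum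
  rw [regularizedHGFun, regularizedHGFunSeries, hsum, ← tsum_mul_left, residueSeries]
  refine tsum_congr fun j => ?_
  have hpos : -(1 / r : ℝ) < (j : ℂ).re := by
    have : (0 : ℝ) < r := by exact_mod_cast Nat.pos_of_ne_zero hr
    have h1 : 0 < (1 / r : ℝ) := by positivity
    have h2 : (0 : ℝ) ≤ j := j.cast_nonneg
    simp only [natCast_re]
    linarith
  have hpoch : ∀ i ∈ Finset.Icc 1 r, Gamma ((i : ℂ) / r) *
      (ascPochhammer ℂ j).eval ((i : ℂ) / r) = Gamma ((i : ℂ) / r + j) := by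
    intro i hi
    have hre : 0 < ((i : ℂ) / r).re := by
      have hi' : (0 : ℝ) < i := by exact_mod_cast (Finset.mem_Icc.1 hi).1
      have hr' : (0 : ℝ) < r := by exact_mod_cast Nat.pos_of_ne_zero hr
      rw [← ofReal_natCast i, ← ofReal_natCast r, ← ofReal_div, ofReal_re]
      positivity
    have hne : ∀ k : ℕ, (i : ℂ) / r ≠ -k := by
      intro k hk
      rw [hk] at hre
      simp at hre
      exact absurd hre (not_lt.2 k.cast_nonneg)
    rw [← Gamma_add_nat_div_Gamma_eq _ hne, mul_div_cancel₀ _ (Gamma_ne_zero hne)]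
  have hmain := prod_Gamma_mul_prod_inv_Gamma hr n hpos
  have hA : (∏ i ∈ Finset.Icc 1 r, Gamma ((i : ℂ) / r)) *
      ∏ i ∈ Finset.Icc 1 r, (ascPochhammer ℂ j).eval ((i : ℂ) / r) =
      ∏ i ∈ Finset.range r, Gamma (((i : ℂ) + 1) / r + j) := by
    rw [← Finset.prod_mul_distrib, Finset.prod_congr rfl hpoch, hIcc]
    simp
  have hB : ∏ i ∈ Finset.Icc 1 r, Gamma (((i : ℂ) - n) / r + j) =
      (∏ i ∈ Finset.range r, (Gamma (((i : ℂ) + 1 - n) / r + j))⁻¹)⁻¹ := by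
    rw [hIcc, Finset.prod_inv_distrib, inv_inv]
    simp
  have hmp (f : ℕ → ℂ) : ((Finset.Icc 1 r).val.map f).prod = ∏ i ∈ Finset.Icc 1 r, f i := rfl
  rw [regularizedHGFunCoeff, Multiset.map_map, Multiset.map_map, residueTerm, ← hmain, ← hA]
  simp only [Function.comp_def, smul_eq_mul, hmp]
  rw [hB, neg_pow z]
  simp only [div_eq_mul_inv, mul_inv, inv_inv]
  ring

/-! ### Decay of the integrand and absolute convergence -/

open Complex in
theorem differentiableAt_reducedIntegrand (r n : ℕ) {z s : ℂ} (hz : z ≠ 0) (hs : ∀ m : ℕ, s ≠ m) :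
    DifferentiableAt ℂ (reducedIntegrand r n z) s := by
  have h1 : DifferentiableAt ℂ (fun s => Gamma (-s)) s :=
    (differentiableAt_Gamma (-s) fun m h => hs m (neg_injective h)).comp s
      differentiable_neg.differentiableAt
  have h2 : DifferentiableAt ℂ (fun s => gridPoly r n s) s := by
    unfold gridPoly; fun_prop
  exact (h1.mul h2).mul (differentiableAt_id.const_cpow (Or.inl hz))

open Complex in
/-- Factorial decay of `Γ(-s)` under shifts to the right, from
`Γ(-s) = -(s + 1) Γ(-s - 1)`. -/
theorem norm_Gamma_neg_add_natCast_le {s : ℂ} (hs : -(1 / 2 : ℝ) < s.re) (m : ℕ) :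
    ‖Gamma (-(s + m))‖ ≤ ‖Gamma (-s)‖ * (2 ^ m / m.factorial) := by
  induction m with
  | zero => simp
  | succ m ih =>
    have hre : ((m : ℝ) + 1) / 2 ≤ (s + (m + 1 : ℕ)).re := by
      have : (0 : ℝ) ≤ m := m.cast_nonneg
      simp only [add_re, natCast_re]
      push_cast
      linarith
    have hpos : (0 : ℝ) < ((m : ℝ) + 1) / 2 := by positivity
    have hnorm := hre.trans (re_le_norm _)
    have hne : -(s + (m + 1 : ℕ)) ≠ 0 := neg_ne_zero.2 (norm_pos_iff.1 (hpos.trans_le hnorm))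
    have hrec := Gamma_add_one _ hne
    rw [show -(s + (m + 1 : ℕ)) + 1 = -(s + m) by push_cast; ring] at hrec
    rw [hrec, norm_mul, norm_neg] at ih
    rw [Nat.factorial_succ, pow_succ]
    push_cast
    have h1 : ((m : ℝ) + 1) / 2 * ‖Gamma (-(s + (m + 1 : ℕ)))‖ ≤
        ‖Gamma (-s)‖ * (2 ^ m / m.factorial) :=
      (mul_le_mul_of_nonneg_right hnorm (norm_nonneg _)).trans ih
    rw [← le_div_iff₀' hpos] at h1
    push_cast at h1
    refine h1.trans (le_of_eq ?_)
    field_simp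

open Complex in
/-- The integrand decays exponentially to the right, uniformly over translates of a compact set
that avoids the poles. -/
theorem exists_norm_reducedIntegrand_add_natCast_le (r n : ℕ) {z : ℂ} (hz : z ≠ 0) {K : Set ℂ}
    (hK : IsCompact K) (hre : ∀ s ∈ K, -(1 / 2 : ℝ) < s.re) (hpole : ∀ s ∈ K, ∀ m : ℕ, s ≠ m) :
    ∃ C : ℝ, 0 ≤ C ∧ ∀ s ∈ K, ∀ m : ℕ,
      ‖reducedIntegrand r n z (s + m)‖ ≤ C * Real.exp (-m) := by
  have hcont : ContinuousOn
      (fun s => Gamma (-s) * z ^ s * ((n.factorial * Real.exp (‖s‖ + n) : ℝ) : ℂ)) K := by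
    intro s hs
    have h1 : ContinuousAt (fun s => Gamma (-s)) s :=
      (continuousAt_Gamma (-s) fun m h => hpole s hs m (neg_injective h)).comp
        continuous_neg.continuousAt
    have h2 : ContinuousAt (fun s : ℂ => z ^ s) s := continuousAt_id.const_cpow (Or.inl hz)
    have h3 : Continuous (fun s : ℂ => ((n.factorial * Real.exp (‖s‖ + n) : ℝ) : ℂ)) := by
      fun_prop
    exact ((h1.mul h2).mul h3.continuousAt).continuousWithinAt
  obtain ⟨B, hB⟩ := hK.exists_bound_of_continuousOn hcont
  -- one factor `e` in `A` pays for the growth of `gridPoly`, the other for the final `exp (-m)`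
  set A : ℝ := 2 * ‖z‖ * Real.exp 2
  refine ⟨|B| * Real.exp A, by positivity, fun s hs m => ?_⟩
  have hG := norm_Gamma_neg_add_natCast_le (hre s hs) m
  have hQ := norm_gridPoly_le (r := r) n (s + m)
  have hQ' : ‖gridPoly r n (s + m)‖ ≤ n.factorial * Real.exp (‖s‖ + n) * Real.exp m := by
    refine hQ.trans ?_
    rw [mul_assoc, ← Real.exp_add (‖s‖ + n)]
    refine mul_le_mul_of_nonneg_left (Real.exp_le_exp.2 ?_) (by positivity)
    have := norm_add_le s (m : ℂ)
    rw [norm_natCast] at this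
    linarith
  have hz' : ‖z ^ (s + m)‖ = ‖z ^ s‖ * ‖z‖ ^ m := by
    rw [cpow_add _ _ hz, cpow_natCast, norm_mul, norm_pow]
  have hBs := (hB s hs).trans (le_abs_self B)
  rw [norm_mul, norm_mul, norm_real, Real.norm_of_nonneg (by positivity)] at hBs
  have hA := Real.pow_div_factorial_le_exp A (by positivity) m
  have hexp : Real.exp m * Real.exp m = Real.exp 2 ^ m := by
    rw [← Real.exp_nat_mul, ← Real.exp_add]; ring_nf
  have hexp' : Real.exp m * Real.exp (-m) = 1 := by rw [← Real.exp_add]; simp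
  calc ‖reducedIntegrand r n z (s + m)‖
      = ‖Gamma (-(s + m))‖ * ‖gridPoly r n (s + m)‖ * ‖z ^ (s + m)‖ := by
        rw [reducedIntegrand, norm_mul, norm_mul]
    _ ≤ (‖Gamma (-s)‖ * (2 ^ m / m.factorial)) *
        (n.factorial * Real.exp (‖s‖ + n) * Real.exp m) * (‖z ^ s‖ * ‖z‖ ^ m) := by
        rw [hz']; gcongr
    _ = (‖Gamma (-s)‖ * ‖z ^ s‖ * (n.factorial * Real.exp (‖s‖ + n))) *
        (A ^ m / m.factorial) * Real.exp (-m) := by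
        simp only [A]
        rw [mul_pow, mul_pow, ← hexp]
        linear_combination (-(‖Gamma (-s)‖ * ‖z ^ s‖ * (n.factorial * Real.exp (‖s‖ + n)) *
          (2 ^ m * ‖z‖ ^ m * Real.exp m / m.factorial))) * hexp'
    _ ≤ |B| * Real.exp A * Real.exp (-m) := by gcongr

open Complex in
theorem integrableOn_reducedIntegrand_horizontal (r n : ℕ) {z : ℂ} (hz : z ≠ 0) {a T : ℝ}
    (ha : -(1 / 2 : ℝ) < a) (hT : T ≠ 0) :
    IntegrableOn (fun t : ℝ => reducedIntegrand r n z ((t : ℂ) + (T : ℂ) * I)) (Set.Ioi a) := by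
  have hcont : Continuous fun t : ℝ => reducedIntegrand r n z ((t : ℂ) + (T : ℂ) * I) := by
    refine continuous_iff_continuousAt.2 fun t => ?_
    have h : ∀ m : ℕ, (t : ℂ) + (T : ℂ) * I ≠ m := fun m h => hT (by simpa using congrArg im h)
    exact ContinuousAt.comp (f := fun t : ℝ => (t : ℂ) + (T : ℂ) * I)
      (differentiableAt_reducedIntegrand r n hz h).continuousAt (by fun_prop)
  obtain ⟨C, hC, hb⟩ := exists_norm_reducedIntegrand_add_natCast_le r n hz
    (K := (fun t : ℝ => (t : ℂ) + (T : ℂ) * I) '' Set.Icc a (a + 1))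
    (isCompact_Icc.image (by fun_prop))
    (by rintro _ ⟨t, ht, rfl⟩; simpa using ha.trans_le ht.1)
    (by rintro _ ⟨t, ht, rfl⟩ m h; exact hT (by simpa using congrArg im h))
  refine Integrable.mono' ((integrableOn_exp_neg_Ioi a).const_mul (C * Real.exp (a + 1)))
    hcont.aestronglyMeasurable ?_
  refine (ae_restrict_iff' measurableSet_Ioi).2 (Filter.Eventually.of_forall fun t ht => ?_)
  -- `t` is the translate by `⌊t - a⌋` of a point of `[a, a + 1]`
  have ht' : 0 ≤ t - a := by linarith [Set.mem_Ioi.1 ht]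
  have h1 := Nat.floor_le ht'
  have h2 := Nat.lt_floor_add_one (t - a)
  have h := hb (((t - ⌊t - a⌋₊ : ℝ) : ℂ) + (T : ℂ) * I)
    ⟨t - ⌊t - a⌋₊, ⟨by linarith, by linarith⟩, rfl⟩ ⌊t - a⌋₊
  rw [show ((t - ⌊t - a⌋₊ : ℝ) : ℂ) + (T : ℂ) * I + (⌊t - a⌋₊ : ℂ) = t + T * I by
    push_cast; ring] at h
  refine h.trans ?_
  rw [mul_assoc, ← Real.exp_add]
  gcongr
  linarith

open Complex in
theorem loopIntegrable_reducedIntegrand (r n : ℕ) {z : ℂ} (hz : z ≠ 0) {a T : ℝ}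
    (ha : -(1 / 2 : ℝ) < a) (ha' : ∀ m : ℕ, a ≠ m) (hT : 0 < T) :
    LoopIntegrable (reducedIntegrand r n z) a T := by
  refine ⟨?_, ?_, integrableOn_reducedIntegrand_horizontal r n hz ha hT.ne'⟩
  · simpa [← sub_eq_add_neg] using
      integrableOn_reducedIntegrand_horizontal r n hz ha (neg_ne_zero.2 hT.ne')
  · refine Continuous.intervalIntegrable (continuous_iff_continuousAt.2 fun y => ?_) _ _
    have h : ∀ m : ℕ, (a : ℂ) + (y : ℂ) * I ≠ m := fun m h => ha' m (by simpa using congrArg re h)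
    exact ContinuousAt.comp (f := fun y : ℝ => (a : ℂ) + (y : ℂ) * I)
      (differentiableAt_reducedIntegrand r n hz h).continuousAt (by fun_prop)

/-! ### The loop integral as a sum of residues -/

open Complex in
theorem Gamma_add_natCast_sub {s : ℂ} (j : ℕ) (hs : ∀ k < j, s ≠ (k : ℂ)) :
    Gamma (j - s) = (∏ k ∈ Finset.range j, ((k : ℂ) - s)) * Gamma (-s) := by
  induction j with
  | zero => simp
  | succ j ih =>
    have hne : (j : ℂ) - s ≠ 0 := sub_ne_zero.2 (hs j j.lt_succ_self).symm
    rw [show ((j + 1 : ℕ) : ℂ) - s = (j - s) + 1 by push_cast; ring, Gamma_add_one _ hne,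
      ih fun k hk => hs k (hk.trans j.lt_succ_self), Finset.prod_range_succ]
    ring

theorem prod_range_natCast_sub_natCast (j : ℕ) :
    ∏ k ∈ Finset.range j, ((k : ℂ) - j) = (-1) ^ j * j.factorial := by
  induction j with
  | zero => simp
  | succ j ih =>
    rw [Finset.prod_range_succ', Nat.factorial_succ]
    have : ∏ k ∈ Finset.range j, (((k + 1 : ℕ) : ℂ) - (j + 1 : ℕ)) =
        ∏ k ∈ Finset.range j, ((k : ℂ) - j) :=
      Finset.prod_congr rfl fun k _ => by push_cast; ring
    rw [this, ih]
    push_cast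
    ring

open Complex in
/-- Moving the left edge of the loop across the pole at `j` picks up the residue there. -/
theorem loopIntegral_reducedIntegrand_sub_succ (r n : ℕ) {z : ℂ} (hz : z ≠ 0) {σ T : ℝ}
    (hσ : -(1 / 2 : ℝ) < σ) (hσ' : σ < 0) (hT : 0 < T) (j : ℕ) :
    loopIntegral (reducedIntegrand r n z) (σ + j) T -
      loopIntegral (reducedIntegrand r n z) (σ + (j + 1 : ℕ)) T = residueTerm r n z j := by
  have hj : (0 : ℝ) ≤ j := j.cast_nonneg
  have hnat (m : ℕ) : σ + j ≠ m := by
    intro h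
    have h1 : (m : ℝ) < j := by linarith
    have h2 : (j : ℝ) < m + 1 := by linarith
    norm_cast at h1 h2
    omega
  have hI := loopIntegrable_reducedIntegrand r n hz (a := σ + j) (T := T) (by linarith) hnat hT
  rw [loopIntegral_sub_loopIntegral (by push_cast; linarith) hI]
  -- `g s = (s - j) Γ(-s) Q(s) z ^ s`, written so that it is regular at `s = j`
  let g (s : ℂ) : ℂ :=
    -(Gamma ((j + 1 : ℕ) - s) / ∏ k ∈ Finset.range j, ((k : ℂ) - s)) * gridPoly r n s * z ^ s
  have hmem (s : ℂ) (hs : s ∈ Set.Icc (σ + j) (σ + (j + 1 : ℕ)) ×ℂ Set.Icc (-T) T) :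
      σ + j ≤ s.re ∧ s.re < j + 1 := by
    have := (mem_reProdIm.1 hs).1
    refine ⟨this.1, ?_⟩
    have := this.2
    push_cast at this
    linarith
  have hk (s : ℂ) (hs : s ∈ Set.Icc (σ + j) (σ + (j + 1 : ℕ)) ×ℂ Set.Icc (-T) T) (k : ℕ)
      (hkj : k < j) : s ≠ k := by
    rintro rfl
    have h1 := (hmem _ hs).1
    have h2 : (k : ℝ) + 1 ≤ j := by exact_mod_cast hkj
    simp only [natCast_re] at h1
    linarith
  have hprod (s : ℂ) (hs : s ∈ Set.Icc (σ + j) (σ + (j + 1 : ℕ)) ×ℂ Set.Icc (-T) T) :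
      ∏ k ∈ Finset.range j, ((k : ℂ) - s) ≠ 0 :=
    Finset.prod_ne_zero_iff.2 fun k hkj =>
      sub_ne_zero.2 (hk s hs k (Finset.mem_range.1 hkj)).symm
  rw [rectBoundaryIntegral_of_simple_pole (c := (j : ℝ)) (g := g) (by linarith)
    (by push_cast; linarith) hT]
  · simp only [g, ofReal_natCast]
    rw [show ((j + 1 : ℕ) : ℂ) - j = 1 by push_cast; ring, Gamma_one,
      prod_range_natCast_sub_natCast, cpow_natCast, residueTerm]
    have hpi : (Real.pi : ℂ) ≠ 0 := by exact_mod_cast Real.pi_ne_zero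
    have hI := I_ne_zero
    have hf : (j.factorial : ℂ) ≠ 0 := by exact_mod_cast j.factorial_ne_zero
    have hs : ((-1 : ℂ) ^ j) * (-1) ^ j = 1 := by rw [← mul_pow]; simp
    have hs0 : ((-1 : ℂ) ^ j) ≠ 0 := pow_ne_zero _ (by simp)
    field_simp
    linear_combination (-gridPoly r n j) * hs
  · intro s hs
    have h1 : DifferentiableAt ℂ (fun s : ℂ => Gamma ((j + 1 : ℕ) - s)) s := by
      refine DifferentiableAt.comp (g := Gamma) (f := fun s : ℂ => ((j + 1 : ℕ) : ℂ) - s) s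
        (differentiableAt_Gamma _ fun m h => ?_) (by fun_prop)
      have h3 := congrArg re h
      have h4 : (0 : ℝ) ≤ m := m.cast_nonneg
      have h5 := (hmem s hs).2
      simp at h3
      linarith
    have h2 : DifferentiableAt ℂ (fun s : ℂ => ∏ k ∈ Finset.range j, ((k : ℂ) - s)) s := by
      fun_prop
    have h3 : DifferentiableAt ℂ (fun s => gridPoly r n s) s := by
      unfold gridPoly; fun_prop
    exact ((((h1.div h2 (hprod s hs)).neg).mul h3).mul
      (differentiableAt_id.const_cpow (Or.inl hz))).differentiableWithinAt
  · intro s hs hsj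
    have hsj' : s ≠ j := by simpa using hsj
    have hG := Gamma_add_natCast_sub (s := s) (j + 1) fun k hkj => by
      rcases Nat.lt_succ_iff_lt_or_eq.1 hkj with h | rfl
      · exact hk s hs k h
      · exact hsj'
    rw [Finset.prod_range_succ] at hG
    have h1 := hprod s hs
    have h2 : s - j ≠ 0 := sub_ne_zero.2 hsj'
    simp only [g, reducedIntegrand, ofReal_natCast]
    rw [hG]
    field_simp
    ring

open Complex in
/-- The loop integral vanishes as the loop moves to the right. -/
theorem tendsto_loopIntegral_reducedIntegrand (r n : ℕ) {z : ℂ} (hz : z ≠ 0) {σ T : ℝ}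
    (hσ : -(1 / 2 : ℝ) < σ) (hσ' : σ < 0) (hT : 0 < T) :
    Filter.Tendsto (fun N : ℕ => loopIntegral (reducedIntegrand r n z) (σ + N) T)
      Filter.atTop (nhds 0) := by
  have hI := loopIntegrable_reducedIntegrand r n hz hσ
    (fun m h => absurd (h ▸ hσ') (not_lt.2 m.cast_nonneg)) hT
  have htop : Filter.Tendsto (fun N : ℕ => σ + (N : ℝ)) Filter.atTop Filter.atTop :=
    Filter.tendsto_atTop_add_const_left _ _ tendsto_natCast_atTop_atTop
  have tail {φ : ℝ → ℂ} (hφ : IntegrableOn φ (Set.Ioi σ)) :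
      Filter.Tendsto (fun N : ℕ => ∫ t in Set.Ioi (σ + N), φ t) Filter.atTop (nhds 0) := by
    have h := (intervalIntegral_tendsto_integral_Ioi σ hφ htop).const_sub (∫ t in Set.Ioi σ, φ t)
    rw [sub_self] at h
    refine h.congr fun N => ?_
    have := intervalIntegral.integral_Ioi_sub_Ioi hφ
      (le_add_of_nonneg_right (N.cast_nonneg : (0 : ℝ) ≤ N))
    rw [← this, sub_sub_cancel]
  obtain ⟨C, hC, hb⟩ := exists_norm_reducedIntegrand_add_natCast_le r n hz
    (K := (fun y : ℝ => (σ : ℂ) + (y : ℂ) * I) '' Set.Icc (-T) T)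
    (isCompact_Icc.image (by fun_prop))
    (by rintro _ ⟨t, ht, rfl⟩; simpa using hσ)
    (by
      rintro _ ⟨t, ht, rfl⟩ m h
      have h1 : σ = m := by simpa using congrArg re h
      exact absurd (h1 ▸ hσ') (not_lt.2 m.cast_nonneg))
  have vert : Filter.Tendsto (fun N : ℕ => ∫ y in (-T)..T,
      reducedIntegrand r n z (((σ + N : ℝ) : ℂ) + (y : ℂ) * I)) Filter.atTop (nhds 0) := by
    have hlim : Filter.Tendsto (fun N : ℕ => C * Real.exp (-N) * |T - -T|) Filter.atTop
        (nhds 0) := by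
      have := (Real.tendsto_exp_neg_atTop_nhds_zero.comp
        (tendsto_natCast_atTop_atTop (R := ℝ))).const_mul C |>.mul_const |T - -T|
      simpa using this
    refine squeeze_zero_norm (fun N => ?_) hlim
    refine intervalIntegral.norm_integral_le_of_norm_le_const fun y hy => ?_
    rw [Set.uIoc_of_le (by linarith)] at hy
    have := hb _ ⟨y, Set.Ioc_subset_Icc_self hy, rfl⟩ N
    rwa [show (σ : ℂ) + (y : ℂ) * I + N = ((σ + N : ℝ) : ℂ) + y * I by push_cast; ring] at this
  have h := (((tail hI.1).neg.add (vert.const_mul I)).add (tail hI.2.2)).const_mul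
    (2 * (Real.pi : ℂ) * I)⁻¹
  simpa [loopIntegral] using h

open Complex in
/-- The partial sums of the residues are differences of loop integrals, which converge to the
integral over the initial loop. -/
theorem loopIntegral_reducedIntegrand (r n : ℕ) {z : ℂ} (hz : z ≠ 0) {σ T : ℝ}
    (hσ : -(1 / 2 : ℝ) < σ) (hσ' : σ < 0) (hT : 0 < T) :
    loopIntegral (reducedIntegrand r n z) σ T = residueSeries r n z := by
  have h1 := (summable_residueTerm r n z).hasSum.tendsto_sum_nat
  have h2 := (tendsto_loopIntegral_reducedIntegrand r n hz hσ hσ' hT).const_sub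
    (loopIntegral (reducedIntegrand r n z) σ T)
  rw [sub_zero] at h2
  refine tendsto_nhds_unique h2 (h1.congr fun N => ?_)
  rw [← Finset.sum_congr rfl fun j _ =>
    loopIntegral_reducedIntegrand_sub_succ r n hz hσ hσ' hT j,
    Finset.sum_range_sub' fun j : ℕ => loopIntegral (reducedIntegrand r n z) (σ + j) T]
  simp

theorem loopIntegral_congr {f g : ℂ → ℂ} {a b T : ℝ} (hab : b < a)
    (h : ∀ s : ℂ, b < s.re → f s = g s) :
    loopIntegral f a T = loopIntegral g a T ∧ (LoopIntegrable g a T → LoopIntegrable f a T) := by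
  have e1 : Set.EqOn (fun t : ℝ => f ((t : ℂ) - (T : ℂ) * Complex.I))
      (fun t : ℝ => g ((t : ℂ) - (T : ℂ) * Complex.I)) (Set.Ioi a) :=
    fun t ht => h _ (by simpa using hab.trans ht)
  have e2 : (fun y : ℝ => f ((a : ℂ) + (y : ℂ) * Complex.I)) =
      fun y : ℝ => g ((a : ℂ) + (y : ℂ) * Complex.I) :=
    funext fun y => h _ (by simpa using hab)
  have e3 : Set.EqOn (fun t : ℝ => f ((t : ℂ) + (T : ℂ) * Complex.I))
      (fun t : ℝ => g ((t : ℂ) + (T : ℂ) * Complex.I)) (Set.Ioi a) :=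
    fun t ht => h _ (by simpa using hab.trans ht)
  refine ⟨?_, fun hg => ⟨?_, ?_, ?_⟩⟩
  · rw [loopIntegral, loopIntegral, setIntegral_congr_fun measurableSet_Ioi e1, e2,
      setIntegral_congr_fun measurableSet_Ioi e3]
  · exact hg.1.congr_fun e1.symm measurableSet_Ioi
  · rw [e2]; exact hg.2.1
  · exact hg.2.2.congr_fun e3.symm measurableSet_Ioi

/-! ### The Meijer function and the generalized Hermite function -/

theorem hasMeijerG_residueSeries {r : ℕ} (hr : 2 ≤ r) (n : ℕ) {z : ℂ} (hz : z ≠ 0) :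
    HasMeijerG 1 r (upperParams r) (lowerParams r n) z (residueSeries r n z) := by
  have hr0 : r ≠ 0 := by omega
  have hr' : (2 : ℝ) ≤ r := by exact_mod_cast hr
  have hhalf : (1 / r : ℝ) ≤ 1 / 2 := one_div_le_one_div_of_le two_pos hr'
  have hcongr (s : ℂ) (hs : -(1 / r : ℝ) < s.re) :=
    meijerIntegrand_eq_reducedIntegrand hr0 n z hs
  refine ⟨by omega, le_rfl, hz, Or.inl r.lt_succ_self, ?_, fun σ T hL => ?_, fun σ T hL => ?_⟩
  · have : 0 < (1 / r : ℝ) := by positivity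
    exact ⟨-(1 / r) / 2, 1, (isMeijerLoop_iff hr0 n _ _).2 ⟨one_pos, by linarith, by linarith⟩⟩
  · obtain ⟨hT, h1, h2⟩ := (isMeijerLoop_iff hr0 n σ T).1 hL
    exact (loopIntegral_congr h2 hcongr).2 (loopIntegrable_reducedIntegrand r n hz (by linarith)
      (fun m h => absurd (h ▸ h1) (not_lt.2 m.cast_nonneg)) hT)
  · obtain ⟨hT, h1, h2⟩ := (isMeijerLoop_iff hr0 n σ T).1 hL
    rw [(loopIntegral_congr h2 hcongr).1]
    exact loopIntegral_reducedIntegrand r n hz (by linarith) h1 hT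

theorem mainTheorem6 (r n : ℕ) (hr : 2 ≤ r) (x : ℂ) (hx : x ≠ 0) :
    HasMeijerG 1 r (upperParams r) (lowerParams r n) (x ^ r)
      (meijerG 1 r (upperParams r) (lowerParams r n) (x ^ r)) ∧
    generalizedHermite r n x =
      Complex.exp (x ^ r) * (-(r : ℂ) / x) ^ n *
        meijerG 1 r (upperParams r) (lowerParams r n) (x ^ r) ∧
    generalizedHermite r n x =
      Complex.exp (x ^ r) * (-(r : ℂ) / x) ^ n *
        ((∏ i ∈ Finset.Icc 1 r, Complex.Gamma ((i : ℂ) / r)) *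
          Complex.regularizedHGFun
            ((Finset.Icc 1 r).val.map fun i : ℕ => (i : ℂ) / r)
            ((Finset.Icc 1 r).val.map fun i : ℕ => ((i : ℂ) - n) / r)
            (-(x ^ r))) := by
  have hr0 : r ≠ 0 := by omega
  have hG := hasMeijerG_residueSeries hr n (pow_ne_zero r hx)
  have hH : generalizedHermite r n x =
      Complex.exp (x ^ r) * (-(r : ℂ) / x) ^ n * residueSeries r n (x ^ r) := by
    rw [generalizedHermite, iteratedDeriv_exp_neg_pow hr0 n hx, neg_div, neg_pow ((r : ℂ) / x)]
    ring
  rw [hG.meijerG_eq, prod_Gamma_mul_regularizedHGFun hr0]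
  exact ⟨hG, hH, hH⟩
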